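/- Let $X$ be a compact metrizable space and $T:X\to 2^X$ an upper semi-continuous multi-valued map with closed (possibly empty) values; equivalently, the graph $gr(T)=\{(x,x')\in X^2: x'\in T(x)\}$ is closed in $X^2$. Let $\pi_T,\pi_T':gr(T)\to X$ be $\pi_T(x,x')=x$, $\pi_T'(x,x')=x'$, and let $\hat T:gr(T)\to 2^{gr(T)}$ be the graph system $\hat T=\pi_T^{-1}\circ\pi_T'$, i.e. $\hat T(x,x')=\{(y,y')\in gr(T): y=x'\}$. Let $f:X\to\mathbb R$ be continuous, and let $\hat f:gr(T)\to\mathbb R$ be $\hat f(x,x')=f(x)$. For a multi-valued map $S:Y\to 2^Y$ (here $(Y,S)=(X,T)$ or $(gr(T),\hat T)$) a Borel probability measure $\mu$ on $Y$ is called $S$-invariant if $\mu(A)\le\mu(S^{-1}A)$ for every Borel set $A\subseteq Y$, where $S^{-1}A=\{y\in Y: S(y)\cap A\ne\emptyset\}$; $\mathcal M_S(Y)$ denotes the set of these measures. For continuous $g:Y\to\mathbb R$ put $$\beta(Y,S,g)=\sup_{\mu\in\mathcal M_S(Y)}\int g\,d\mu\in[-\infty,\infty]\qquad(\sup\emptyset=-\infty),$$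 $$\mathcal M_{\max}(Y,S,g)=\Big\{\mu\in\mathcal M_S(Y):\int g\,d\mu=\beta(Y,S,g)\Big\}.$$ Then $$\beta(X,T,f)=\beta\big(gr(T),\hat T,\hat f\big),$$ $$\mathcal M_{\max}(X,T,f)=\big\{\nu\circ\pi_T^{-1}:\nu\in\mathcal M_{\max}\big(gr(T),\hat T,\hat f\big)\big\},$$ $$\mathcal M_{\max}\big(gr(T),\hat T,\hat f\big)=\big\{\nu\in\mathcal M_{\hat T}(gr(T)):\nu\circ\pi_T^{-1}\in\mathcal M_{\max}(X,T,f)\big\}.$$ -/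

import Mathlib

open MeasureTheory Set Topology

namespace MultiValued

section Basic

variable {X : Type*}

/-- The graph `gr(T) = {(x, x') ∈ X² : x' ∈ T(x)}` of a set-valued map. -/
def graph (T : X → Set X) : Set (X × X) := {p | p.2 ∈ T p.1}

/-- The preimage `T⁻¹(A) = ⋃_{a ∈ A} T⁻¹(a)`, where `T⁻¹(a) = {x : a ∈ T(x)}`. -/
def preimage (T : X → Set X) (A : Set X) : Set X := {x | ∃ a ∈ A, a ∈ T x}

/-- The projection `π_T : gr(T) → X`, `(x, x') ↦ x`. -/
def proj (T : X → Set X) (p : graph T) : X := p.1.1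

/-- The projection `π_T' : gr(T) → X`, `(x, x') ↦ x'`. -/
def proj' (T : X → Set X) (p : graph T) : X := p.1.2

/-- The graph system `T̂ = π_T⁻¹ ∘ π_T' : gr(T) → 2^{gr(T)}`. -/
def graphMap (T : X → Set X) (p : graph T) : Set (graph T) := proj T ⁻¹' {proj' T p}

end Basic

/-- `(X, T)` is a multi-valued topological dynamical system (on a compact metrizable space `X`):
`T` is upper semi-continuous, with closed values. The sets `T x` may be empty. -/
structure IsSystem {X : Type*} [TopologicalSpace X] (T : X → Set X) : Prop where
  upperSemicontinuous : UpperHemicontinuous T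
  isClosed_value : ∀ x, IsClosed (T x)

/-- The set `M_T` of `T`-invariant probability measures: `μ(A) ≤ μ(T⁻¹A)` for all measurable `A`.
(The measure of `T⁻¹A`, an analytic set, is that of the completion of `μ`, which on such
sets is the outer measure.) -/
def invariantMeasures {X : Type*} [MeasurableSpace X] (T : X → Set X) :
    Set (ProbabilityMeasure X) :=
  {μ | ∀ A : Set X, MeasurableSet A → (μ : Measure X) A ≤ (μ : Measure X) (preimage T A)}

section Optimization

variable {X : Type*} [TopologicalSpace X] [MeasurableSpace X]

/-- The maximum ergodic average `β(X, T, f) = sup_{μ ∈ M_T} ∫ f dμ`, an element of `[-∞, ∞]`, with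
`sup ∅ = -∞`. -/
noncomputable def maxErgodicAverage (T : X → Set X) (f : C(X, ℝ)) : EReal :=
  ⨆ μ ∈ invariantMeasures T, ((∫ x, f x ∂(μ : Measure X) : ℝ) : EReal)

/-- The set `M_max(X, T, f)` of `f`-maximizing measures. -/
def maximizingMeasures (T : X → Set X) (f : C(X, ℝ)) : Set (ProbabilityMeasure X) :=
  {μ | μ ∈ invariantMeasures T ∧
    ((∫ x, f x ∂(μ : Measure X) : ℝ) : EReal) = maxErgodicAverage T f}

end Optimization

lemma continuous_proj {X : Type*} [TopologicalSpace X] (T : X → Set X) : Continuous (proj T) :=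
  continuous_fst.comp continuous_subtype_val

lemma measurable_proj {X : Type*} [MeasurableSpace X] (T : X → Set X) : Measurable (proj T) :=
  measurable_fst.comp measurable_subtype_coe

/-- The graph function `f̂ : gr(T) → ℝ`, `f̂(x, x') = f(x)`. -/
def graphFunction {X : Type*} [TopologicalSpace X] (T : X → Set X) (f : C(X, ℝ)) :
    C(graph T, ℝ) :=
  ⟨fun p => f p.1.1, f.continuous.comp (continuous_proj T)⟩

/-- The projection `ν ∘ π_T⁻¹` of a probability measure `ν` on `gr(T)`. -/
noncomputable def pushProj {X : Type*} [MeasurableSpace X] (T : X → Set X)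
    (ν : ProbabilityMeasure (graph T)) : ProbabilityMeasure X :=
  ν.map (measurable_proj T).aemeasurable

/-- The graph of a multi-valued system is closed. -/
lemma IsSystem.isClosed_graph {X : Type*} [TopologicalSpace X] [CompactSpace X] [T2Space X]
    {T : X → Set X} (hT : IsSystem T) : IsClosed (graph T) := by
  rw [← isOpen_compl_iff, isOpen_iff_mem_nhds]
  rintro ⟨x, y⟩ hxy
  have hy : y ∉ T x := hxy
  obtain ⟨U, V, hU, hV, hTU, hyV, hUV⟩ :=
    SeparatedNhds.of_isCompact_isCompact (hT.isClosed_value x).isCompact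
      (isCompact_singleton (x := y)) (disjoint_singleton_right.mpr hy)
  have h1 := upperHemicontinuous_iff_forall_isOpen.mp hT.upperSemicontinuous x U hU hTU
  have h2 : V ∈ 𝓝 y := hV.mem_nhds (hyV rfl)
  rw [nhds_prod_eq]
  filter_upwards [Filter.prod_mem_prod h1 h2] with p hp hmem
  exact disjoint_left.mp hUV (hp.1 hmem) hp.2

/-- The graph system `(gr(T), T̂)` of a multi-valued system is again a multi-valued system. -/
lemma IsSystem.graphMap {X : Type*} [TopologicalSpace X] [CompactSpace X] [T2Space X]
    {T : X → Set X} (hT : IsSystem T) : IsSystem (graphMap T) := by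
  have : CompactSpace (graph T) := isCompact_iff_compactSpace.mp hT.isClosed_graph.isCompact
  refine ⟨?_, fun p => isClosed_singleton.preimage (continuous_proj T)⟩
  have h := isClosedMap_iff_upperHemicontinuous.mp (continuous_proj T).isClosedMap
  rw [upperHemicontinuous_iff_forall_isOpen] at h ⊢
  intro p u hu hp
  have hc : Continuous (proj' T) := continuous_snd.comp continuous_subtype_val
  exact hc.continuousAt.eventually (h (proj' T p) u hu hp)

end MultiValued

open MeasureTheory Set Topology

namespace MultiValued

/-! Push-forward by `proj T` preserves invariance and the integral of `f`, so everything rests on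
lifting an invariant `μ` to the graph (`exists_pushProj_eq`). Invariance of `μ` on closed sets is
exactly Hall's condition for a measure on `graph T` with both marginals `μ`, which Strassen's
theorem supplies through Riesz extension and Riesz–Markov. Equal marginals already force invariance
under `graphMap T`, since the preimage of `B` is `proj' T ⁻¹' (proj T '' B)`. -/

section Coupling

variable {X Y Z : Type*} [TopologicalSpace X] [CompactSpace X] [MeasurableSpace X] [BorelSpace X]
  [TopologicalSpace Y] [CompactSpace Y] [MeasurableSpace Y] [BorelSpace Y]

/-- The easy half of Kantorovich duality for couplings carried by a correspondence `X ← Z → Y`. -/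
lemma integral_add_integral_nonneg (p : Z → X) (q : Z → Y)
    (μ : Measure X) [IsProbabilityMeasure μ] (ρ : Measure Y) [IsProbabilityMeasure ρ]
    (h : ∀ A : Set Y, IsClosed A → ρ A ≤ μ (p '' (q ⁻¹' A))) (u : C(X, ℝ)) (v : C(Y, ℝ))
    (huv : ∀ z, 0 ≤ u (p z) + v (q z)) : 0 ≤ ∫ x, u x ∂μ + ∫ y, v y ∂ρ := by
  have hu : Integrable u μ := u.continuous.integrable_of_hasCompactSupport
    (HasCompactSupport.of_compactSpace _)
  have hv : Integrable v ρ := v.continuous.integrable_of_hasCompactSupport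
    (HasCompactSupport.of_compactSpace _)
  -- This shift makes `c + u` and `c - v` nonnegative, so the layer-cake formula applies to both.
  set c : ℝ := ‖u‖ + ‖v‖
  have hcu (x : X) : 0 ≤ c + u x := by
    have := neg_le_of_abs_le (u.norm_coe_le_norm x)
    have := norm_nonneg v
    simp only [c]; linarith
  have hcv (y : Y) : 0 ≤ c - v y := by
    have := le_of_abs_le (v.norm_coe_le_norm y)
    have := norm_nonneg u
    simp only [c]; linarith
  have hcu' : Integrable (fun x => c + u x) μ := (integrable_const c).add hu
  have hcv' : Integrable (fun y => c - v y) ρ := (integrable_const c).sub hv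
  have key : ∫ y, c - v y ∂ρ ≤ ∫ x, c + u x ∂μ := by
    rw [← ENNReal.ofReal_le_ofReal_iff (integral_nonneg hcu),
      ofReal_integral_eq_lintegral_ofReal hcu' (.of_forall hcu),
      ofReal_integral_eq_lintegral_ofReal hcv' (.of_forall hcv),
      lintegral_eq_lintegral_meas_le μ (.of_forall hcu) hcu'.aemeasurable,
      lintegral_eq_lintegral_meas_le ρ (.of_forall hcv) hcv'.aemeasurable]
    refine lintegral_mono fun t => ?_
    -- Hall's condition is applied to the closed superlevel set `{t ≤ c - v}`; `huv` sends its image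
    -- into `{t ≤ c + u}`.
    refine (h _ (isClosed_le continuous_const (by fun_prop))).trans (measure_mono ?_)
    rintro _ ⟨z, hz, rfl⟩
    have hz : t ≤ c - v (q z) := hz
    have := huv z
    simp only [mem_ofPred_eq]
    linarith
  rw [integral_sub (integrable_const c) hv, integral_add (integrable_const c) hu] at key
  simp only [integral_const, probReal_univ, one_smul] at key
  linarith

variable [TopologicalSpace Z] [CompactSpace Z] [T2Space Z] [MeasurableSpace Z] [BorelSpace Z]

/-- A positive linear functional on `C(Z, ℝ)`, for `Z` compact, is integration against a finite
measure. -/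
lemma exists_measure_integral_eq (g : C(Z, ℝ) →ₗ[ℝ] ℝ) (hg : ∀ w : C(Z, ℝ), 0 ≤ w → 0 ≤ g w) :
    ∃ ν : Measure Z, IsFiniteMeasure ν ∧ ∀ w : C(Z, ℝ), ∫ z, w z ∂ν = g w := by
  let e : CompactlySupportedContinuousMap Z ℝ →ₗ[ℝ] C(Z, ℝ) :=
    { toFun := fun w => w.toContinuousMap
      map_add' := fun _ _ => rfl
      map_smul' := fun _ _ => rfl }
  let Λ : CompactlySupportedContinuousMap Z ℝ →ₚ[ℝ] ℝ :=
    PositiveLinearMap.mk₀ (g ∘ₗ e) fun w hw => hg _ hw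
  refine ⟨RealRMK.rieszMeasure Λ, inferInstance, fun w => ?_⟩
  exact RealRMK.integral_rieszMeasure Λ (CompactlySupportedContinuousMap.continuousMapEquiv w)

/-- **Strassen's theorem** for a compact correspondence `X ← Z → Y`: Hall's condition on closed sets
yields a measure on `Z` with prescribed marginals. -/
theorem exists_probabilityMeasure_map_eq [HasOuterApproxClosed X] [HasOuterApproxClosed Y]
    (p : C(Z, X)) (q : C(Z, Y))
    (μ : Measure X) [IsProbabilityMeasure μ] (ρ : Measure Y) [IsProbabilityMeasure ρ]
    (h : ∀ A : Set Y, IsClosed A → ρ A ≤ μ (p '' (q ⁻¹' A))) :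
    ∃ ν : Measure Z, IsProbabilityMeasure ν ∧ ν.map p = μ ∧ ν.map q = ρ := by
  have hu (u : C(X, ℝ)) : Integrable u μ := u.continuous.integrable_of_hasCompactSupport
    (HasCompactSupport.of_compactSpace _)
  have hv (v : C(Y, ℝ)) : Integrable v ρ := v.continuous.integrable_of_hasCompactSupport
    (HasCompactSupport.of_compactSpace _)
  let Φ : C(X, ℝ) × C(Y, ℝ) →ₗ[ℝ] C(Z, ℝ) :=
    { toFun := fun w => w.1.comp p + w.2.comp q
      map_add' := fun a b => by ext z; simp; ring
      map_smul' := fun r a => by ext z; simp }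
  let l : C(X, ℝ) × C(Y, ℝ) →ₗ[ℝ] ℝ :=
    { toFun := fun w => ∫ x, w.1 x ∂μ + ∫ y, w.2 y ∂ρ
      map_add' := fun a b => by
        simp only [Prod.fst_add, Prod.snd_add, ContinuousMap.add_apply]
        rw [integral_add (hu _) (hu _), integral_add (hv _) (hv _)]
        ring
      map_smul' := fun r a => by
        simp only [Prod.smul_fst, Prod.smul_snd, ContinuousMap.smul_apply, smul_eq_mul,
          integral_const_mul, RingHom.id_apply]
        ring }
  have hl (w) (hw : 0 ≤ Φ w) : 0 ≤ l w := integral_add_integral_nonneg p q μ ρ h w.1 w.2 hw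
  -- Hence `l` descends to the range of `Φ`, and `l ∘ₗ s` does not depend on the section `s`.
  have hl0 (w) (hw : Φ w = 0) : l w = 0 := by
    refine le_antisymm ?_ (hl w hw.ge)
    have := hl (-w) (by rw [map_neg, hw, neg_zero])
    rw [map_neg] at this
    linarith
  have : Module.Projective ℝ (LinearMap.range Φ) :=
    .of_basis (Module.Basis.ofVectorSpace ℝ (LinearMap.range Φ))
  obtain ⟨s, hs⟩ := Φ.rangeRestrict.exists_rightInverse_of_surjective Φ.range_rangeRestrict
  have hΦs (y : LinearMap.range Φ) : Φ (s y) = y := congr_arg Subtype.val (LinearMap.congr_fun hs y)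
  let F : C(Z, ℝ) →ₗ.[ℝ] ℝ := ⟨LinearMap.range Φ, l ∘ₗ s⟩
  obtain ⟨g, hgF, hg⟩ := riesz_extension (PointedCone.positive ℝ C(Z, ℝ)) F
    (fun y hy => hl _ (by rw [hΦs]; exact hy)) (fun y => by
      -- Constants lie in the range of `Φ`, which gives the cofinality needed for a positive
      -- extension.
      refine ⟨⟨Φ (ContinuousMap.const X ‖y‖, 0), _, rfl⟩, fun z => ?_⟩
      have := neg_le_of_abs_le (y.norm_coe_le_norm z)
      simp [Φ]
      linarith)
  have hgΦ (w) : g (Φ w) = l w := by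
    have h1 : g (Φ w) = l (s ⟨Φ w, w, rfl⟩) := hgF ⟨Φ w, w, rfl⟩
    have h2 := hl0 (s ⟨Φ w, w, rfl⟩ - w) (by rw [map_sub, hΦs, sub_self])
    rw [map_sub] at h2
    linarith
  obtain ⟨ν, hν, hνg⟩ := exists_measure_integral_eq g fun w hw => hg w hw
  have hp : ν.map p = μ := by
    refine ext_of_forall_integral_eq_of_IsFiniteMeasure fun u => ?_
    rw [integral_map p.continuous.aemeasurable u.continuous.aestronglyMeasurable]
    have := (hνg (Φ (u.toContinuousMap, 0))).trans (hgΦ _)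
    simpa [Φ, l] using this
  have hq : ν.map q = ρ := by
    refine ext_of_forall_integral_eq_of_IsFiniteMeasure fun v => ?_
    rw [integral_map q.continuous.aemeasurable v.continuous.aestronglyMeasurable]
    have := (hνg (Φ (0, v.toContinuousMap))).trans (hgΦ _)
    simpa [Φ, l] using this
  refine ⟨ν, ⟨?_⟩, hp, hq⟩
  have := measure_univ (μ := μ)
  rwa [← hp, Measure.map_apply p.continuous.measurable .univ] at this

end Coupling

section Lifting

variable {X : Type*}

lemma preimage_graphMap (T : X → Set X) (B : Set (graph T)) :
    preimage (graphMap T) B = proj' T ⁻¹' (proj T '' B) := by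
  ext p
  exact ⟨fun ⟨q, hq, hqp⟩ => ⟨q, hq, hqp⟩, fun ⟨q, hq, hqp⟩ => ⟨q, hq, hqp⟩⟩

lemma preimage_eq_image (T : X → Set X) (A : Set X) :
    preimage T A = proj T '' (proj' T ⁻¹' A) := by
  ext x
  exact ⟨fun ⟨a, ha, hax⟩ => ⟨⟨(x, a), hax⟩, ha, rfl⟩, fun ⟨q, hq, hqx⟩ => ⟨_, hq, hqx ▸ q.2⟩⟩

lemma preimage_graphMap_preimage_subset (T : X → Set X) (A : Set X) :
    preimage (graphMap T) (proj T ⁻¹' A) ⊆ proj T ⁻¹' preimage T A := by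
  rw [preimage_graphMap]
  rintro p ⟨q, hq, hqp⟩
  exact ⟨p.1.2, by change proj' T p ∈ A; rw [← hqp]; exact hq, p.2⟩

/-- `preimage T A` need not be measurable, but the last inequality holds for outer measure on any
set. -/
lemma pushProj_mem_invariantMeasures [MeasurableSpace X] {T : X → Set X}
    {ν : ProbabilityMeasure (graph T)} (hν : ν ∈ invariantMeasures (graphMap T)) :
    pushProj T ν ∈ invariantMeasures T := by
  intro A hA
  change (ν : Measure (graph T)).map (proj T) A ≤ (ν : Measure (graph T)).map (proj T) _
  rw [Measure.map_apply (measurable_proj T) hA]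
  calc (ν : Measure (graph T)) (proj T ⁻¹' A)
      ≤ (ν : Measure (graph T)) (preimage (graphMap T) (proj T ⁻¹' A)) :=
        hν _ (measurable_proj T hA)
    _ ≤ (ν : Measure (graph T)) (proj T ⁻¹' preimage T A) :=
        measure_mono (preimage_graphMap_preimage_subset T A)
    _ ≤ _ := Measure.le_map_apply (measurable_proj T).aemeasurable _

variable [TopologicalSpace X] [MeasurableSpace X]

lemma integral_pushProj [OpensMeasurableSpace X] {T : X → Set X}
    (ν : ProbabilityMeasure (graph T)) (f : C(X, ℝ)) :
    ∫ x, f x ∂(pushProj T ν : Measure X) =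
      ∫ p, graphFunction T f p ∂(ν : Measure (graph T)) :=
  integral_map (measurable_proj T).aemeasurable f.continuous.stronglyMeasurable.aestronglyMeasurable

variable [CompactSpace X] [TopologicalSpace.MetrizableSpace X] [BorelSpace X]

/-- Every `T`-invariant measure lifts to an invariant measure of the graph system. -/
theorem exists_pushProj_eq {T : X → Set X} (hT : IsSystem T) {μ : ProbabilityMeasure X}
    (hμ : μ ∈ invariantMeasures T) :
    ∃ ν ∈ invariantMeasures (graphMap T), pushProj T ν = μ := by
  let := TopologicalSpace.metrizableSpaceMetric X
  have : CompactSpace (graph T) := isCompact_iff_compactSpace.mp hT.isClosed_graph.isCompact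
  obtain ⟨ν, hν, hp, hq⟩ := exists_probabilityMeasure_map_eq (Z := graph T)
    ⟨proj T, continuous_proj T⟩ ⟨proj' T, continuous_snd.comp continuous_subtype_val⟩
    (μ : Measure X) (μ : Measure X) fun A hA => by
      have := hμ A hA.measurableSet
      rwa [preimage_eq_image] at this
  have hm' : Measurable (proj' T) := measurable_snd.comp measurable_subtype_coe
  refine ⟨⟨ν, hν⟩, fun B hB => ?_, Subtype.ext hp⟩
  change ν B ≤ ν (preimage (graphMap T) B)
  -- `proj T '' B` may fail to be Borel; for compact `K` the image is compact, so the marginals can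
  -- be compared on it.
  rw [hB.measure_eq_iSup_isCompact_of_ne_top (measure_ne_top _ _)]
  refine iSup₂_le fun K hKB => iSup_le fun hK => ?_
  have hKm : MeasurableSet (proj T '' K) := (hK.image (continuous_proj T)).measurableSet
  calc ν K ≤ ν (proj T ⁻¹' (proj T '' K)) := measure_mono (subset_preimage_image _ _)
    _ = ν.map (proj T) (proj T '' K) := (Measure.map_apply (measurable_proj T) hKm).symm
    _ = ν.map (proj' T) (proj T '' K) := congr_arg (· (proj T '' K)) (hp.trans hq.symm)
    _ = ν (proj' T ⁻¹' (proj T '' K)) := Measure.map_apply hm' hKm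
    _ ≤ ν (preimage (graphMap T) B) := by
      rw [preimage_graphMap]
      exact measure_mono (preimage_mono (image_mono hKB))

lemma maxErgodicAverage_graphMap {T : X → Set X} (hT : IsSystem T) (f : C(X, ℝ)) :
    maxErgodicAverage T f = maxErgodicAverage (graphMap T) (graphFunction T f) := by
  refine le_antisymm (iSup₂_le fun μ hμ => ?_) (iSup₂_le fun ν hν => ?_)
  · obtain ⟨ν, hν, rfl⟩ := exists_pushProj_eq hT hμ
    rw [integral_pushProj]
    exact le_iSup₂_of_le ν hν le_rfl
  · rw [← integral_pushProj]
    exact le_iSup₂_of_le (pushProj T ν) (pushProj_mem_invariantMeasures hν) le_rfl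

lemma mem_maximizingMeasures_graphMap {T : X → Set X} (hT : IsSystem T) (f : C(X, ℝ))
    {ν : ProbabilityMeasure (graph T)} :
    ν ∈ maximizingMeasures (graphMap T) (graphFunction T f) ↔
      ν ∈ invariantMeasures (graphMap T) ∧ pushProj T ν ∈ maximizingMeasures T f := by
  unfold maximizingMeasures
  simp only [mem_ofPred_eq, integral_pushProj, maxErgodicAverage_graphMap hT]
  exact ⟨fun h => ⟨h.1, pushProj_mem_invariantMeasures h.1, h.2⟩, fun h => ⟨h.1, h.2.2⟩⟩

end Lifting

end MultiValued


theorem mainTheorem5 {X : Type*} [TopologicalSpace X] [CompactSpace X]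
    [TopologicalSpace.MetrizableSpace X] [MeasurableSpace X] [BorelSpace X]
    (T : X → Set X) (hT : MultiValued.IsSystem T) (f : C(X, ℝ)) :
    MultiValued.maxErgodicAverage T f =
        MultiValued.maxErgodicAverage (MultiValued.graphMap T) (MultiValued.graphFunction T f) ∧
      MultiValued.maximizingMeasures T f =
        MultiValued.pushProj T ''
          MultiValued.maximizingMeasures (MultiValued.graphMap T)
            (MultiValued.graphFunction T f) ∧
      MultiValued.maximizingMeasures (MultiValued.graphMap T) (MultiValued.graphFunction T f) =
        {ν | ν ∈ MultiValued.invariantMeasures (MultiValued.graphMap T) ∧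
          MultiValued.pushProj T ν ∈ MultiValued.maximizingMeasures T f} := by
  have h (ν) := MultiValued.mem_maximizingMeasures_graphMap hT f (ν := ν)
  refine ⟨MultiValued.maxErgodicAverage_graphMap hT f, Set.ext fun μ => ⟨fun hμ => ?_, ?_⟩,
    Set.ext h⟩
  · obtain ⟨ν, hν, rfl⟩ := MultiValued.exists_pushProj_eq hT hμ.1
    exact ⟨ν, (h ν).mpr ⟨hν, hμ⟩, rfl⟩
  · rintro ⟨ν, hν, rfl⟩
    exact ((h ν).mp hν).2
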